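/- Let $G$ be a compact connected Lie group and let $H\le G$ be a closed connected subgroup such that $G/H$ is simply connected. Let $k\ge 0$ be an integer with $k\le \operatorname{rk}G-\operatorname{rk}H$, where $\operatorname{rk}$ denotes the dimension of a maximal torus, and suppose that $T^k\times H$ is a subgroup of $G$, i.e. $T^k\le G$ is a $k$-dimensional torus which commutes elementwise with $H$ and satisfies $T^k\cap H=\{1\}$, so that the subgroup $T^kH$ generated by $T^k$ and $H$ is their internal direct product $T^k\times H$. Then the integral singular homology $H_*(\Omega(G/H);\mathbb Z)$ of the based loop space of $G/H$ is torsion free if and only if $H_*(\Omega(G/(T^k\times H));\mathbb Z)$ is torsion free. -/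

import Mathlib

open scoped Manifold ContDiff

universe u

/-- The `n`-th singular homology group `Hₙ(X; ℤ)` of a topological space `X`. (The coefficient
group `ℤ` is lifted to the universe of `X`, as the homology functor requires.) -/
noncomputable def integralHomology (n : ℕ) (X : Type u) [TopologicalSpace X] :
    ModuleCat.{u} ℤ :=
  ((AlgebraicTopology.singularHomologyFunctor (ModuleCat.{u} ℤ) n).obj
    (ModuleCat.of ℤ (ULift.{u} ℤ))).obj (TopCat.of X)

/-- The graded group `H_*(X; ℤ)` is torsion free: every `Hₙ(X; ℤ)` is. -/
def HomologyTorsionFree (X : Type u) [TopologicalSpace X] : Prop :=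
  ∀ n : ℕ, Module.IsTorsionFree ℤ (integralHomology n X)

/-- The subgroup `T` is a `k`-dimensional torus: with the subspace topology it is isomorphic,
as a topological group, to the product of `k` circles. -/
def IsTorusOfDim {G : Type u} [Group G] [TopologicalSpace G] (T : Subgroup G) (k : ℕ) : Prop :=
  Nonempty (T ≃ₜ* (Fin k → Circle))

/-- The rank of a Lie group: the largest dimension of a torus contained in it (for a compact
connected group, the common dimension of its maximal tori). -/
noncomputable def lieRank (G : Type u) [Group G] [TopologicalSpace G] : ℕ∞ :=
  ⨆ (T : Subgroup G) (n : ℕ) (_ : IsTorusOfDim T n), (n : ℕ∞)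

/-- The based loop space `Ω(G/K)` of a coset space, at the identity coset, with the compact-open
topology. -/
abbrev CosetLoopSpace {G : Type u} [Group G] [TopologicalSpace G] (K : Subgroup G) : Type u :=
  LoopSpace (G ⧸ K) (QuotientGroup.mk (1 : G) : G ⧸ K)

/-! Put X = G/H and B = G/(T×H). Right multiplication makes X → B the quotient by a free torus
action. X is simply connected, so the orbit of the base point contracts in X. Closing up lifts of
loops along this contraction gives r : ΩB → ΩX, and the endpoints of the lifts give μ : ΩB → T. Then
(r, μ) exhibits ΩB as a homotopy retract of ΩX × T, and Ωp exhibits ΩX as a homotopy retract of ΩB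
(`homologyTorsionFree_loopSpace_iff`). Torsion-freeness passes to homotopy retracts, so no full
equivalence ΩB ≃ ΩX × T is needed.

Two ingredients remain. A product with a circle preserves torsion-freeness: ℤ acts freely on the
singular simplices of Y × ℝ and trivially on homology, so the long exact sequence of
`SSet.shortExact_chainComplexMap` makes H_n(Y × S¹) an extension of a subgroup of H_{n-1}(Y) by
H_n(Y). Lifting all loops of B at once needs homotopy lifting over an arbitrary parameter space.
Instead of local sections, Tietze extension and Haar averaging yield a transport between nearby
fibres (`exists_transport`), which is iterated in small steps. -/

/-- An extension of torsion-free modules is torsion free. -/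
theorem Module.IsTorsionFree.of_exact {A M N P : Type*} [CommRing A] [IsDomain A]
    [AddCommGroup M] [AddCommGroup N] [AddCommGroup P] [Module A M] [Module A N] [Module A P]
    [Module.IsTorsionFree A M] [Module.IsTorsionFree A P] (f : M →ₗ[A] N) (g : N →ₗ[A] P)
    (hf : Function.Injective f) (hfg : ∀ z, g z = 0 → ∃ y, f y = z) :
    Module.IsTorsionFree A N := by
  refine .of_smul_eq_zero fun a z haz ↦ or_iff_not_imp_left.2 fun ha ↦ ?_
  obtain ⟨y, rfl⟩ := hfg z <| (smul_eq_zero.1 (by rw [← map_smul, haz, map_zero])).resolve_left ha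
  rw [← map_smul] at haz
  rw [(smul_eq_zero.1 (hf (haz.trans (map_zero f).symm))).resolve_left ha, map_zero]

/-! ### Chains on free ℤ-sets and their orbit sets. -/

section Chains

open CategoryTheory Limits AlgebraicTopology

variable {A : Type*} [CommRing A] (R : ModuleCat.{u} A)

/-- A coproduct of copies of a module is the module of finitely supported functions. -/
noncomputable def sigmaIsoFinsupp (S : Type u) :
    (∐ fun _ : S ↦ R) ≅ ModuleCat.of A (S →₀ R) where
  hom := Sigma.desc fun s ↦ ModuleCat.ofHom (Finsupp.lsingle s)
  inv := ModuleCat.ofHom (Finsupp.lsum A fun s ↦ (Sigma.ι (fun _ : S ↦ R) s).hom)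
  hom_inv_id := by
    refine Sigma.hom_ext _ _ fun s ↦ ?_
    rw [Sigma.ι_desc_assoc, Category.comp_id]
    ext r
    simp
  inv_hom_id := by
    ext s r : 3
    simp

variable {R} {S Q : Type u}

theorem sigmaIsoFinsupp_map (f : S → Q) (x : (∐ fun _ : S ↦ R : ModuleCat A)) :
    (sigmaIsoFinsupp R Q).hom ((sigmaConst.obj R).map (↾f) x) =
      Finsupp.mapDomain f ((sigmaIsoFinsupp R S).hom x) := by
  have h : (sigmaConst.obj R).map (↾f) ≫ (sigmaIsoFinsupp R Q).hom =
      (sigmaIsoFinsupp R S).hom ≫ ModuleCat.ofHom (Finsupp.lmapDomain R A f) := by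
    refine Sigma.hom_ext _ _ fun s ↦ ?_
    ext r
    simp [sigmaConst, sigmaIsoFinsupp]
  exact ConcreteCategory.congr_hom h x

/-- An invariant function is constant along forward orbits; these are infinite, the support is
finite. -/
theorem Finsupp.eq_zero_of_mapDomain_eq_self {M : Type*} [AddCommMonoid M] {e : S → S}
    (he : Function.Injective e) (hfree : ∀ (s : S) (m : ℕ), e^[m] s = s → m = 0)
    (x : S →₀ M) (hx : Finsupp.mapDomain e x = x) : x = 0 := by
  by_contra h
  obtain ⟨s, hs⟩ := Finsupp.ne_iff.1 h
  have hstep (t : S) : x (e t) = x t := by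
    conv_lhs => rw [← hx]
    exact Finsupp.mapDomain_apply he x t
  have hall (m : ℕ) : x (e^[m] s) = x s := by
    induction m with
    | zero => rfl
    | succ m ih => rw [Function.iterate_succ_apply', hstep, ih]
  have hinj : Function.Injective fun m : ℕ ↦ e^[m] s := by
    intro a b hab
    wlog hle : a ≤ b generalizing a b
    · exact (this hab.symm (le_of_not_ge hle)).symm
    obtain ⟨c, rfl⟩ := Nat.exists_eq_add_of_le hle
    have h1 : e^[a] (e^[c] s) = e^[a] s := by
      rw [← Function.iterate_add_apply]; exact hab.symm
    rw [hfree s c (he.iterate a h1), add_zero]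
  refine Set.infinite_range_of_injective hinj (x.support.finite_toSet.subset ?_)
  rintro _ ⟨m, rfl⟩
  have := hall m
  simp_all

theorem ι_sigmaConst_map (f : S → Q) (s : S) :
    Sigma.ι (fun _ ↦ R) s ≫ (sigmaConst.obj R).map (↾f) = Sigma.ι (fun _ ↦ R) (f s) := by
  simp [sigmaConst]

theorem epi_sigmaConst_map (q : S → Q) (hq : Function.Surjective q) :
    Epi ((sigmaConst.obj R).map (↾q)) := by
  have : (sigmaConst.obj R).map (↾(Function.surjInv hq)) ≫ (sigmaConst.obj R).map (↾q) = 𝟙 _ := by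
    refine Sigma.hom_ext _ _ fun s ↦ ?_
    rw [← Category.assoc, ι_sigmaConst_map, ι_sigmaConst_map, Function.surjInv_eq hq s]
    exact (Category.comp_id _).symm
  exact (IsSplitEpi.mk' ⟨_, this⟩ : IsSplitEpi _).epi

/-- Chains on a free `ℤ`-set resolve chains on the set of orbits. -/
theorem shortExact_sigmaConst (e : S → S) (q : S → Q) (he : Function.Injective e)
    (hfree : ∀ (s : S) (m : ℕ), e^[m] s = s → m = 0) (hq : Function.Surjective q)
    (hfib : ∀ s s', q s = q s' → ∃ m : ℕ, e^[m] s = s' ∨ e^[m] s' = s)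
    (w : ((sigmaConst.obj R).map (↾e) - 𝟙 _) ≫ (sigmaConst.obj R).map (↾q) = 0) :
    (ShortComplex.mk ((sigmaConst.obj R).map (↾e) - 𝟙 _) ((sigmaConst.obj R).map (↾q)) w).ShortExact := by
  have hmono : Mono ((sigmaConst.obj R).map (↾e) - 𝟙 ((sigmaConst.obj R).obj S)) := by
    rw [ModuleCat.mono_iff_injective, injective_iff_map_eq_zero]
    intro x hx
    refine (sigmaIsoFinsupp R S).toLinearEquiv.injective ?_
    rw [map_zero]
    refine Finsupp.eq_zero_of_mapDomain_eq_self he hfree _ ?_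
    refine (sigmaIsoFinsupp_map e x).symm.trans ?_
    exact congrArg (sigmaIsoFinsupp R S).hom (sub_eq_zero.1 hx)
  have hepi := epi_sigmaConst_map (R := R) q hq
  refine ⟨ShortComplex.exact_of_g_is_cokernel _ ?_⟩
  let σ := Function.surjInv hq
  -- A map killed by `e - 1` is constant on orbits, so it factors through `q` by way of any
  -- set-theoretic section `σ`.
  have key {Z : ModuleCat A} (h : (sigmaConst.obj R).obj S ⟶ Z)
      (hh : ((sigmaConst.obj R).map (↾e) - 𝟙 _) ≫ h = 0) :
      (sigmaConst.obj R).map (↾q) ≫ (sigmaConst.obj R).map (↾σ) ≫ h = h := by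
    have hstep (s : S) : Sigma.ι (fun _ ↦ R) (e s) ≫ h = Sigma.ι (fun _ ↦ R) s ≫ h := by
      have := Sigma.ι (fun _ ↦ R) s ≫= hh
      rw [comp_zero, Preadditive.sub_comp, Preadditive.comp_sub, sub_eq_zero, ← Category.assoc,
        ι_sigmaConst_map, Category.id_comp] at this
      exact this
    have hiter (s : S) (m : ℕ) : Sigma.ι (fun _ ↦ R) (e^[m] s) ≫ h = Sigma.ι (fun _ ↦ R) s ≫ h := by
      induction m with
      | zero => rfl
      | succ m ih => rw [Function.iterate_succ_apply', hstep, ih]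
    refine Sigma.hom_ext _ _ fun s ↦ ?_
    rw [← Category.assoc, ι_sigmaConst_map, ← Category.assoc, ι_sigmaConst_map]
    obtain ⟨m, h | h⟩ := hfib (σ (q s)) s (Function.surjInv_eq hq _)
    · rw [← hiter _ m, h]
    · rw [← h, hiter]
  exact CokernelCofork.IsColimit.ofπ _ w (fun h _ ↦ (sigmaConst.obj R).map (↾σ) ≫ h)
    (fun h hh ↦ key h hh)
    fun h hh m hm ↦ by rw [← cancel_epi ((sigmaConst.obj R).map (↾q)), hm, key h hh]

/-- Chains on a simplicial set with a free `ℤ`-action resolve chains on its quotient. -/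
theorem SSet.shortExact_chainComplexMap {S Q : SSet.{u}} (e : S ⟶ S) (q : S ⟶ Q)
    (he : ∀ n, Function.Injective (e.app n))
    (hfree : ∀ n (s : S.obj n) (m : ℕ), (e.app n)^[m] s = s → m = 0)
    (hq : ∀ n, Function.Surjective (q.app n))
    (hfib : ∀ n (s s' : S.obj n), q.app n s = q.app n s' →
      ∃ m : ℕ, (e.app n)^[m] s = s' ∨ (e.app n)^[m] s' = s)
    (w : (SSet.chainComplexMap e R - 𝟙 _) ≫ SSet.chainComplexMap q R = 0) :
    (ShortComplex.mk (SSet.chainComplexMap e R - 𝟙 _) (SSet.chainComplexMap q R) w).ShortExact := by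
  refine HomologicalComplex.shortExact_of_degreewise_shortExact _ fun n ↦ ?_
  exact shortExact_sigmaConst (R := R) _ _ (he (.op (.mk n))) (hfree _) (hq _) (hfib _)
    (congrArg (fun f ↦ f.f n) w)

/-- If `ℤ` acts freely on `S` with quotient `Q`, and trivially on homology, then the homology of
`Q` is torsion free as soon as that of `S` is. -/
theorem isTorsionFree_homology_of_free_int {R : ModuleCat.{u} ℤ} {S Q : SSet.{u}} (e : S ⟶ S)
    (q : S ⟶ Q) (heq : e ≫ q = q)
    (he : ∀ n, Function.Injective (e.app n))
    (hfree : ∀ n (s : S.obj n) (m : ℕ), (e.app n)^[m] s = s → m = 0)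
    (hq : ∀ n, Function.Surjective (q.app n))
    (hfib : ∀ n (s s' : S.obj n), q.app n s = q.app n s' →
      ∃ m : ℕ, (e.app n)^[m] s = s' ∨ (e.app n)^[m] s' = s)
    (htriv : ∀ n, SSet.homologyMap e R n = 𝟙 _)
    (htf : ∀ n, Module.IsTorsionFree ℤ ((SSet.chainComplex S R).homology n)) (n : ℕ) :
    Module.IsTorsionFree ℤ ((SSet.chainComplex Q R).homology n) := by
  have w : (SSet.chainComplexMap e R - 𝟙 _) ≫ SSet.chainComplexMap q R = 0 := by
    rw [Preadditive.sub_comp, Category.id_comp, sub_eq_zero]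
    exact (((SSet.chainComplexFunctor (ModuleCat.{u} ℤ)).obj R).map_comp e q).symm.trans
      (congrArg _ heq)
  have hS := SSet.shortExact_chainComplexMap (R := R) e q he hfree hq hfib w
  have hzero (n : ℕ) :
      HomologicalComplex.homologyMap (SSet.chainComplexMap e R - 𝟙 (SSet.chainComplex S R)) n = 0 := by
    rw [HomologicalComplex.homologyMap_sub, HomologicalComplex.homologyMap_id, sub_eq_zero]
    exact htriv n
  have hinj : Function.Injective (SSet.homologyMap q R n) := by
    rw [← ModuleCat.mono_iff_injective]
    exact (hS.homology_exact₂ n).mono_g (hzero n)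
  -- In degree 0 no connecting map leaves H₀(Q), and H₀(S) → H₀(Q) is onto, so the third term is
  -- taken to be zero.
  rcases n with _ | n
  · have : Epi ((SSet.chainComplexMap q R).f 0) := epi_sigmaConst_map _ (hq _)
    have hsurj := (ModuleCat.epi_iff_surjective _).1
      (HomologicalComplex.epi_homologyMap_of_epi_of_not_rel (SSet.chainComplexMap q R) 0 (by simp))
    have := htf 0
    exact Module.IsTorsionFree.of_exact (SSet.homologyMap q R 0).hom (0 : _ →ₗ[ℤ] PUnit) hinj
      fun z _ ↦ hsurj z
  · have := htf n
    have := htf (n + 1)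
    exact Module.IsTorsionFree.of_exact (SSet.homologyMap q R (n + 1)).hom
      (hS.δ (n + 1) n rfl).hom hinj
      ((ShortComplex.moduleCat_exact_iff _).1 (hS.homology_exact₃ (n + 1) n rfl))

end Chains

/-! ### Homotopy retracts. -/

section SingularHomology

open CategoryTheory Limits AlgebraicTopology

variable {X Y : Type u} [TopologicalSpace X] [TopologicalSpace Y]

/-- A homotopy retract of a space with torsion-free homology has torsion-free homology. -/
theorem HomologyTorsionFree.of_retract (f : C(X, Y)) (g : C(Y, X))
    (h : (g.comp f).Homotopic (.id X)) (hY : HomologyTorsionFree Y) : HomologyTorsionFree X := by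
  intro n
  let F := (singularHomologyFunctor (ModuleCat.{u} ℤ) n).obj (ModuleCat.of ℤ (ULift.{u} ℤ))
  have hfg : F.map (TopCat.ofHom f) ≫ F.map (TopCat.ofHom g) = 𝟙 _ := by
    rw [← F.map_comp, ← F.map_id]
    obtain ⟨H⟩ := h
    exact TopCat.Homotopy.congr_homologyMap_singularChainComplexFunctor
      (f := TopCat.ofHom f ≫ TopCat.ofHom g) (g := 𝟙 (TopCat.of X)) H
      (ModuleCat.of ℤ (ULift.{u} ℤ)) n
  have := hY n
  let φ : integralHomology n X ⟶ integralHomology n Y := F.map (TopCat.ofHom f)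
  have hφ : Function.Injective φ := Function.LeftInverse.injective (g := F.map (TopCat.ofHom g))
    fun x ↦ ConcreteCategory.congr_hom hfg x
  exact hφ.moduleIsTorsionFree φ φ.hom.map_smul

end SingularHomology

/-! ### Products with circles and tori. -/

section Circle

open CategoryTheory Limits AlgebraicTopology

/-- Maps from contractible spaces lift along surjective covering maps. -/
theorem IsCoveringMap.exists_lift_of_contractibleSpace {A B E : Type*} [TopologicalSpace A]
    [TopologicalSpace B] [TopologicalSpace E] [ContractibleSpace A] {p : E → B}
    (hp : IsCoveringMap p) (hsurj : Function.Surjective p) (f : C(A, B)) :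
    ∃ g : C(A, E), ∀ a, p (g a) = f a := by
  obtain ⟨a₀, ⟨H⟩⟩ := id_nullhomotopic A
  obtain ⟨e₀, he₀⟩ := hsurj (f a₀)
  have h0 (a : A) : (f.comp H.symm.toContinuousMap) (0, a) = p ((ContinuousMap.const A e₀) a) := by
    simp [he₀]
  refine ⟨(hp.liftHomotopy _ _ h0).comp ((ContinuousMap.const A 1).prodMk (.id A)), fun a ↦ ?_⟩
  have := congrFun (hp.liftHomotopy_lifts _ _ h0) (1, a)
  simpa using this

instance (n : SimplexCategory) : ContractibleSpace (SimplexCategory.toTop.{u}.obj n) := by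
  have : ContractibleSpace (stdSimplex ℝ (Fin (n.len + 1))) :=
    (convex_stdSimplex ℝ _).contractibleSpace ⟨_, single_mem_stdSimplex ℝ 0⟩
  exact (Homeomorph.ulift (X := stdSimplex ℝ (Fin (n.len + 1)))).contractibleSpace

variable (X : Type u) [TopologicalSpace X]

/-- The generator of the deck transformation group of `X × ℝ → X × ℝ / ℤ`. -/
def shiftByOne : C(X × ℝ, X × ℝ) where
  toFun z := (z.1, z.2 + 1)

/-- The universal cover of the circle, times `X`. -/
def prodToAddCircle : C(X × ℝ, X × UnitAddCircle) where
  toFun z := (z.1, (z.2 : UnitAddCircle))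
  continuous_toFun := by fun_prop

variable {X}

theorem toSSet_map_shiftByOne_iterate {n : SimplexCategoryᵒᵖ}
    (s : (TopCat.toSSet.obj (TopCat.of (X × ℝ))).obj n) (m : ℕ) (a) :
    (((TopCat.toSSet.map (TopCat.ofHom (shiftByOne X))).app n)^[m] s).down.hom a =
      ((s.down.hom a).1, (s.down.hom a).2 + m) := by
  induction m with
  | zero => simp
  | succ m ih =>
    rw [Function.iterate_succ_apply']
    refine (congrArg (shiftByOne X) ih).trans ?_
    simp [shiftByOne, add_assoc]

theorem UnitAddCircle.coe_add_natCast (x : ℝ) (m : ℕ) :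
    ((x + m : ℝ) : UnitAddCircle) = (x : UnitAddCircle) := by
  induction m with
  | zero => simp
  | succ m ih => rw [Nat.cast_succ, ← add_assoc, AddCircle.coe_add_period, ih]

theorem HomologyTorsionFree.prod_unitAddCircle (h : HomologyTorsionFree X) :
    HomologyTorsionFree (X × UnitAddCircle) := by
  have hR : HomologyTorsionFree (X × ℝ) := by
    refine h.of_retract ⟨Prod.fst, continuous_fst⟩ ⟨fun x ↦ (x, 0), by fun_prop⟩ ⟨?_⟩
    exact
      { toFun := fun z ↦ (z.2.1, (z.1 : ℝ) * z.2.2)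
        continuous_toFun := by fun_prop
        map_zero_left := by intro z; simp
        map_one_left := by intro z; simp }
  have hcov : IsCoveringMap ((↑) : ℝ → UnitAddCircle) := AddCircle.isCoveringMap_coe 1
  refine isTorsionFree_homology_of_free_int
    (TopCat.toSSet.map (TopCat.ofHom (shiftByOne X)))
    (TopCat.toSSet.map (TopCat.ofHom (prodToAddCircle X))) ?_ ?_ ?_ ?_ ?_ ?_ hR
  · rw [← Functor.map_comp]
    congr 1
    ext z
    · rfl
    · exact AddCircle.coe_add_period 1 z.2
  · intro n s s' hss
    refine ULift.ext _ _ (TopCat.hom_ext (ContinuousMap.ext fun a ↦ ?_))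
    have h1 := toSSet_map_shiftByOne_iterate s 1 a
    have h2 := toSSet_map_shiftByOne_iterate s' 1 a
    rw [Function.iterate_one] at h1 h2
    rw [hss, h2] at h1
    exact Prod.ext (congrArg Prod.fst h1).symm (add_right_cancel (congrArg Prod.snd h1)).symm
  · intro n s m hm
    obtain ⟨a⟩ : Nonempty (SimplexCategory.toTop.{u}.obj n.unop) := inferInstance
    have h1 := toSSet_map_shiftByOne_iterate s m a
    rw [hm] at h1
    simpa using congrArg Prod.snd h1
  -- Simplices are contractible, so they lift through ℝ → ℝ/ℤ.
  · intro n s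
    obtain ⟨g, hg⟩ := hcov.exists_lift_of_contractibleSpace QuotientAddGroup.mk_surjective
      (⟨fun a ↦ (s.down.hom a).2, continuous_snd.comp s.down.hom.continuous⟩ :
        C(SimplexCategory.toTop.{u}.obj n.unop, UnitAddCircle))
    refine ⟨⟨TopCat.ofHom ⟨fun a ↦ ((s.down.hom a).1, g a),
      (continuous_fst.comp s.down.hom.continuous).prodMk g.continuous⟩⟩, ?_⟩
    exact ULift.ext _ _ (TopCat.hom_ext (ContinuousMap.ext fun a ↦ Prod.ext rfl (hg a)))
  -- Two lifts of a simplex differ by an integer at `a₀`, hence everywhere by uniqueness of lifts on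
  -- a connected space. Its sign decides which lift is shifted.
  · intro n s s' hss
    have hpt (a : SimplexCategory.toTop.{u}.obj n.unop) : prodToAddCircle X (s.down.hom a) = prodToAddCircle X (s'.down.hom a) :=
      congrArg (fun t ↦ t.down.hom a) hss
    have hfst (a) : (s.down.hom a).1 = (s'.down.hom a).1 :=
      congrArg (fun z : X × UnitAddCircle ↦ z.1) (hpt a)
    have hsnd (a) : ((s.down.hom a).2 : UnitAddCircle) = ((s'.down.hom a).2 : UnitAddCircle) :=
      congrArg (fun z : X × UnitAddCircle ↦ z.2) (hpt a)
    have : PreconnectedSpace (SimplexCategory.toTop.{u}.op.obj n).unop :=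
      inferInstanceAs (PreconnectedSpace (SimplexCategory.toTop.{u}.obj n.unop))
    obtain ⟨a₀⟩ : Nonempty (SimplexCategory.toTop.{u}.obj n.unop) := inferInstance
    have hcont (t : (TopCat.toSSet.obj (TopCat.of (X × ℝ))).obj n) :
        Continuous fun a ↦ (t.down.hom a).2 := continuous_snd.comp t.down.hom.continuous
    have key (t t' : (TopCat.toSSet.obj (TopCat.of (X × ℝ))).obj n)
        (h1 : ∀ a, (t.down.hom a).1 = (t'.down.hom a).1)
        (h2 : ∀ a, ((t.down.hom a).2 : UnitAddCircle) = ((t'.down.hom a).2 : UnitAddCircle))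
        (m : ℕ) (hm : (t.down.hom a₀).2 + m = (t'.down.hom a₀).2) :
        ((TopCat.toSSet.map (TopCat.ofHom (shiftByOne X))).app n)^[m] t = t' := by
      have h3 := hcov.eq_of_comp_eq ((hcont t).add continuous_const) (hcont t')
        (funext fun a ↦ ((UnitAddCircle.coe_add_natCast _ m).trans (h2 a))) a₀ hm
      refine ULift.ext _ _ (TopCat.hom_ext (ContinuousMap.ext fun a ↦ ?_))
      rw [toSSet_map_shiftByOne_iterate]
      exact Prod.ext (h1 a) (congrFun h3 a)
    obtain ⟨m, hm⟩ := (AddCircle.coe_eq_zero_iff (1 : ℝ)).1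
      ((AddCircle.coe_sub 1 _ _).trans (sub_eq_zero.2 (hsnd a₀).symm))
    rw [zsmul_one] at hm
    obtain ⟨m, rfl | rfl⟩ := m.eq_nat_or_neg
    · exact ⟨m, .inl (key s s' hfst hsnd m (by push_cast at hm; linarith))⟩
    · exact ⟨m, .inr (key s' s (fun a ↦ (hfst a).symm) (fun a ↦ (hsnd a).symm) m
        (by push_cast at hm; linarith))⟩
  · intro n
    refine (TopCat.Homotopy.congr_homologyMap_singularChainComplexFunctor
      (f := TopCat.ofHom (shiftByOne X)) (g := 𝟙 (TopCat.of (X × ℝ))) ?_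
      (ModuleCat.of ℤ (ULift.{u} ℤ)) n).trans ?_
    · exact
        { toFun := fun z ↦ (z.2.1, z.2.2 + (1 - (z.1 : ℝ)))
          continuous_toFun := by fun_prop
          map_zero_left := by intro z; simp [shiftByOne]
          map_one_left := by intro z; simp }
    · rw [CategoryTheory.Functor.map_id, HomologicalComplex.homologyMap_id]
      rfl

theorem HomologyTorsionFree.prod_torus (h : HomologyTorsionFree X) (k : ℕ) :
    HomologyTorsionFree (X × (Fin k → Circle)) := by
  induction k with
  | zero =>
    refine h.of_retract ⟨Prod.fst, continuous_fst⟩ ⟨fun x ↦ (x, 1), by fun_prop⟩ ?_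
    convert ContinuousMap.Homotopic.refl _
    ext z
    · rfl
    · exact congrArg _ (congrFun (Subsingleton.elim _ _) _)
  | succ k ih =>
    let c := AddCircle.homeomorphCircle (T := (1 : ℝ)) one_ne_zero
    refine ih.prod_unitAddCircle.of_retract
      ⟨fun z ↦ ((z.1, fun i ↦ z.2 i.succ), c.symm (z.2 0)), by fun_prop⟩
      ⟨fun w ↦ (w.1.1, Fin.cons (c w.2) w.1.2), by fun_prop⟩ ?_
    convert ContinuousMap.Homotopic.refl _
    ext z i
    · rfl
    · refine Fin.cases ?_ (fun j ↦ ?_) i <;> simp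

end Circle

/-! ### Haar averaging against a character. -/

section Averaging

open MeasureTheory

/-- Currying is continuous into the sup norm, for which integration is 1-Lipschitz; this puts no
condition on `Z`. -/
theorem continuous_integral_of_compactSpace {S Z : Type*} [TopologicalSpace S] [CompactSpace S]
    [MeasurableSpace S] [BorelSpace S] [TopologicalSpace Z] (μ : Measure S) [IsProbabilityMeasure μ]
    (f : C(Z × S, ℂ)) : Continuous fun z ↦ ∫ s, f (z, s) ∂μ := by
  have hint (g : C(S, ℂ)) : Integrable g μ :=
    g.continuous.integrable_of_hasCompactSupport (.of_compactSpace _)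
  have hlip : LipschitzWith 1 fun g : C(S, ℂ) ↦ ∫ s, g s ∂μ := by
    refine LipschitzWith.of_dist_le_mul fun g h ↦ ?_
    rw [dist_eq_norm, dist_eq_norm, ← integral_sub (hint g) (hint h)]
    refine (norm_integral_le_of_norm_le_const (C := ‖g - h‖)
      (.of_forall fun s ↦ (g - h).norm_coe_le_norm s)).trans ?_
    simp
  exact hlip.continuous.comp f.curry.continuous

/-- Averaging over a compact group makes a function equivariant for a given character. -/
theorem exists_equivariant_of_compactSpace {S Z : Type*} [CommGroup S] [TopologicalSpace S]
    [IsTopologicalGroup S] [CompactSpace S] [TopologicalSpace Z] [MulAction S Z]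
    [ContinuousSMul S Z] (χ : S →* Circle) (hχ : Continuous χ) (g : C(Z, ℂ)) :
    ∃ F : C(Z, ℂ), (∀ s z, F (s • z) = χ s * F z) ∧
      ∀ z, (∀ s, g (s • z) = χ s * g z) → F z = g z := by
  let : MeasurableSpace S := borel S
  have : BorelSpace S := ⟨rfl⟩
  let μ : Measure S := Measure.haarMeasure ⊤
  have : IsProbabilityMeasure μ := ⟨Measure.haarMeasure_self⟩
  let f : C(Z × S, ℂ) := ⟨fun w ↦ ((χ w.2)⁻¹ : Circle) * g (w.2 • w.1), by fun_prop⟩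
  refine ⟨⟨_, continuous_integral_of_compactSpace μ f⟩, fun a z ↦ ?_, fun z hz ↦ ?_⟩
  · change ∫ s, f (a • z, s) ∂μ = χ a * ∫ s, f (z, s) ∂μ
    rw [← integral_mul_left_eq_self (fun s ↦ f (z, s)) a, ← integral_const_mul]
    congr 1 with s
    simp only [f, ContinuousMap.coe_mk, map_mul, mul_inv, Circle.coe_mul, mul_smul,
      smul_comm s a z, ← mul_assoc]
    rw [← Circle.coe_mul, mul_inv_cancel]
    simp
  · change ∫ s, f (z, s) ∂μ = g z
    have (s : S) : f (z, s) = g z := by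
      simp only [f, ContinuousMap.coe_mk, hz, ← mul_assoc]
      rw [← Circle.coe_mul, inv_mul_cancel]
      simp
    simp [this]

end Averaging

/-! ### Transport between nearby fibres of a torus bundle. -/

section Bundle

/-- `p : X → B` is the quotient map of a free continuous action of a `k`-torus. -/
structure IsTorusBundle {X B : Type*} [TopologicalSpace X] [TopologicalSpace B] (k : ℕ)
    [MulAction (Fin k → Circle) X] (p : X → B) : Prop where
  isOpenQuotientMap : IsOpenQuotientMap p
  free : ∀ (t : Fin k → Circle) (x : X), t • x = x → t = 1
  apply_eq_iff : ∀ x y, p x = p y ↔ ∃ t : Fin k → Circle, t • x = y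

variable {X B : Type*} [TopologicalSpace X] [TopologicalSpace B] [CompactSpace X] [T2Space X]
  {k : ℕ} [MulAction (Fin k → Circle) X] [ContinuousSMul (Fin k → Circle) X] {p : X → B}

namespace IsTorusBundle

/-- The image is the set of pairs in a common fibre. Closedness lets the division map be extended by
Tietze; the embedding makes division continuous. -/
theorem isClosedEmbedding (h : IsTorusBundle k p) : Topology.IsClosedEmbedding
    fun w : (Fin k → Circle) × X ↦ (w.2, w.1 • w.2) := by
  refine Continuous.isClosedEmbedding (by fun_prop) ?_
  rintro ⟨s, x⟩ ⟨t, y⟩ hw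
  obtain ⟨rfl, h2⟩ := Prod.mk.inj hw
  have := h.free (t⁻¹ * s) x (by rw [mul_smul, inv_smul_eq_iff]; exact h2)
  rw [inv_mul_eq_one.1 this]

/-- The division map of a torus bundle extends to an equivariant function on all pairs. -/
theorem exists_equivariant_division (h : IsTorusBundle k p) (i : Fin k) : ∃ Φ : C(X × X, ℂ),
    (∀ (s t : Fin k → Circle) x y, Φ (s • x, t • y) = ((s i)⁻¹ * t i : Circle) * Φ (x, y)) ∧
    ∀ (t : Fin k → Circle) x, Φ (x, t • x) = t i := by
  obtain ⟨g, hg⟩ := ContinuousMap.exists_extension' h.isClosedEmbedding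
    (⟨fun w ↦ (w.1 i : ℂ), by fun_prop⟩ : C((Fin k → Circle) × X, ℂ))
  replace hg (t : Fin k → Circle) (x : X) : g (x, t • x) = t i := congrFun hg (t, x)
  let : MulAction ((Fin k → Circle) × (Fin k → Circle)) (X × X) :=
    { smul := fun s z ↦ (s.1 • z.1, s.2 • z.2)
      one_smul := fun z ↦ Prod.ext (one_smul _ _) (one_smul _ _)
      mul_smul := fun s t z ↦ Prod.ext (mul_smul _ _ _) (mul_smul _ _ _) }
  have : ContinuousSMul ((Fin k → Circle) × (Fin k → Circle)) (X × X) :=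
    ⟨by change Continuous fun w : ((Fin k → Circle) × (Fin k → Circle)) × (X × X) ↦ (w.1.1 • w.2.1, w.1.2 • w.2.2); fun_prop⟩
  let χ : (Fin k → Circle) × (Fin k → Circle) →* Circle :=
    { toFun := fun s ↦ (s.1 i)⁻¹ * s.2 i
      map_one' := by simp
      map_mul' := fun s t ↦ by simp [mul_mul_mul_comm, mul_comm] }
  obtain ⟨F, hF, hF'⟩ := exists_equivariant_of_compactSpace χ
    (by change Continuous fun s : (Fin k → Circle) × (Fin k → Circle) ↦ (s.1 i)⁻¹ * s.2 i; fun_prop) g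
  refine ⟨F, fun s t x y ↦ hF (s, t) (x, y), fun t x ↦ (hF' (x, t • x) ?_).trans (hg t x)⟩
  intro s
  change g (s.1 • x, s.2 • t • x) = _
  -- The extension is already equivariant on pairs in a common fibre, so averaging leaves it
  -- unchanged there.
  have : s.2 • t • x = (s.2 * t * s.1⁻¹) • s.1 • x := by simp [mul_smul]
  rw [this, hg, hg]
  simp [χ]; ring

/-- Nearby fibres of a torus bundle over a compact base are identified, uniformly on the base. -/
theorem exists_transport (h : IsTorusBundle k p) : ∃ (τ : X × B → X) (m : C(B × B, ℝ)),
    (∀ z, 0 ≤ m z) ∧ (∀ b, m (b, b) ≠ 0) ∧ (∀ x b, p (τ (x, b)) = b) ∧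
    (∀ x, τ (x, p x) = x) ∧ ∀ x b, m (p x, b) ≠ 0 → ContinuousAt τ (x, b) := by
  choose Φ hΦ hΦ' using h.exists_equivariant_division
  have hpsurj := h.isOpenQuotientMap.surjective
  let σ := Function.surjInv hpsurj
  have hσ (b : B) : p (σ b) = b := Function.surjInv_eq hpsurj b
  have hsmul (t : Fin k → Circle) (x : X) : p (t • x) = p x :=
    ((h.apply_eq_iff _ _).2 ⟨t, rfl⟩).symm
  -- the product of the moduli descends to the base
  let M : C(X × X, ℝ) := ⟨fun z ↦ ∏ i, ‖Φ i z‖, by fun_prop⟩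
  let m : B × B → ℝ := fun b ↦ M (σ b.1, σ b.2)
  have hm (x y : X) : m (p x, p y) = M (x, y) := by
    obtain ⟨s, hs⟩ := (h.apply_eq_iff x (σ (p x))).1 (hσ _).symm
    obtain ⟨t, ht⟩ := (h.apply_eq_iff y (σ (p y))).1 (hσ _).symm
    simp only [m, ← hs, ← ht, M, ContinuousMap.coe_mk, hΦ, norm_mul, Circle.norm_coe, one_mul]
  have hmcont : Continuous m := by
    rw [← (h.isOpenQuotientMap.prodMap h.isOpenQuotientMap).continuous_comp_iff]
    convert M.continuous using 1
    ext z
    exact hm z.1 z.2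
  -- the phase of the equivariant functions
  let θ : X × X → Fin k → Circle := fun z i ↦ Circle.exp (Φ i z).arg
  -- `arg` jumps along the negative axis, but its exponential is Φ/‖Φ‖, continuous wherever Φ ≠ 0.
  have hθcoe (z : X × X) (i : Fin k) (hz : Φ i z ≠ 0) : (θ z i : ℂ) = Φ i z / ‖Φ i z‖ := by
    rw [eq_div_iff (by simpa using hz), mul_comm, Circle.coe_exp]
    exact Complex.norm_mul_exp_arg_mul_I _
  have hθsmul (x y : X) (t : Fin k → Circle) (hz : ∀ i, Φ i (x, y) ≠ 0) :
      θ (x, t • y) = t * θ (x, y) := by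
    ext i
    have := hΦ i 1 t x y
    rw [one_smul, Pi.one_apply, inv_one, one_mul] at this
    have hne : Φ i (x, t • y) ≠ 0 := by rw [this]; simpa using hz i
    rw [Pi.mul_apply, Circle.coe_mul, hθcoe _ _ hne, hθcoe _ _ (hz i), this, norm_mul,
      Circle.norm_coe, one_mul, mul_div_assoc]
  have hθcont (z : X × X) (hz : ∀ i, Φ i z ≠ 0) : ContinuousAt θ z := by
    refine continuousAt_pi.2 fun i ↦ ?_
    have hind : Topology.IsInducing fun c : Circle ↦ (c : ℂ) := Topology.IsInducing.subtypeVal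
    refine hind.continuousAt_iff.2 ?_
    have hev : (fun w ↦ Φ i w / ‖Φ i w‖) =ᶠ[nhds z] ((↑) : Circle → ℂ) ∘ fun w ↦ θ w i := by
      filter_upwards [(Φ i).continuous.continuousAt.eventually_ne (hz i)] with w hw
      exact (hθcoe w i hw).symm
    refine ContinuousAt.congr (ContinuousAt.div ?_ ?_ (by simpa using hz i)) hev <;> fun_prop
  -- The phase measures the displacement from `x` to the chosen point over `b`; undoing it gives a
  -- point independent of the choice wherever no Φ vanishes.
  let τ : X × B → X := fun w ↦ (θ (w.1, σ w.2))⁻¹ • σ w.2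
  have hτ (x y : X) (hxy : ∀ i, Φ i (x, y) ≠ 0) : τ (x, p y) = (θ (x, y))⁻¹ • y := by
    obtain ⟨t, ht⟩ := (h.apply_eq_iff y (σ (p y))).1 (hσ _).symm
    simp only [τ, ← ht, hθsmul x y t hxy, mul_inv_rev, mul_smul, inv_smul_smul]
  have hM (z : X × X) (hz : M z ≠ 0) (i : Fin k) : Φ i z ≠ 0 :=
    norm_ne_zero_iff.1 (Finset.prod_ne_zero_iff.1 hz i (Finset.mem_univ i))
  have hdiag (x : X) (i : Fin k) : Φ i (x, x) = 1 := by simpa using hΦ' i 1 x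
  refine ⟨τ, ⟨m, hmcont⟩, fun z ↦ ?_, fun b ↦ ?_,
    fun x b ↦ (hsmul _ _).trans (hσ b), fun x ↦ ?_, fun x b hxb ↦ ?_⟩
  · change 0 ≤ ∏ i, ‖Φ i (σ z.1, σ z.2)‖
    exact Finset.prod_nonneg fun i _ ↦ norm_nonneg _
  · obtain ⟨x, rfl⟩ := hpsurj b
    change m (p x, p x) ≠ 0
    simp [hm, M, hdiag]
  · have : θ (x, x) = 1 := by ext i; simp [θ, hdiag]
    rw [hτ x x fun i ↦ by simp [hdiag], this, inv_one, one_smul]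
  · obtain ⟨y, rfl⟩ := hpsurj b
    change m (p x, p y) ≠ 0 at hxb
    rw [hm] at hxb
    refine (IsOpenQuotientMap.id.prodMap h.isOpenQuotientMap).continuousAt_comp_iff
      (x := (x, y)) |>.1 ?_
    have hev : τ ∘ Prod.map id p =ᶠ[nhds (x, y)] fun z ↦ (θ z)⁻¹ • z.2 := by
      filter_upwards [M.continuous.continuousAt.eventually_ne hxb] with z hz
      exact hτ z.1 z.2 (hM z hz)
    exact ContinuousAt.congr ((hθcont _ (hM _ hxb)).inv.smul continuousAt_snd) hev.symm

end IsTorusBundle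
end Bundle

/-! ### Homotopy lifting by iterated transport. -/

section HomotopyLifting

open Topology unitInterval

/-- A positive step below which a family of paths moves only within the locus `m ≠ 0`. -/
theorem exists_step {Y B : Type*} [TopologicalSpace Y] [TopologicalSpace B] (h : C(Y × I, B))
    (m : C(B × B, ℝ)) (hm : ∀ z, 0 ≤ m z) (hdiag : ∀ b, m (b, b) ≠ 0) :
    ∃ δ : C(Y, ℝ), (∀ y, 0 < δ y) ∧
      ∀ y (s t : I), |(s : ℝ) - t| ≤ δ y → m (h (y, s), h (y, t)) ≠ 0 := by
  -- Both summands vanish together only on the diagonal, where m ≠ 0, so the minimum of `f y` over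
  -- the compact square is positive. Half of it serves as the step.
  let f : Y → I × I → ℝ := fun y w ↦ |(w.1 : ℝ) - w.2| + m (h (y, w.1), h (y, w.2))
  have hf : Continuous ↿f := by
    change Continuous fun z : Y × (I × I) ↦ _
    fun_prop
  have hcont : Continuous fun y ↦ sInf (f y '' Set.univ) := isCompact_univ.continuous_sInf hf
  have hfy (y : Y) : Continuous (f y) := by fun_prop
  have hpos (y : Y) : 0 < sInf (f y '' Set.univ) := by
    obtain ⟨w, -, hw⟩ := isCompact_univ.exists_sInf_image_eq Set.univ_nonempty (hfy y).continuousOn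
    rw [hw]
    refine lt_of_le_of_ne (add_nonneg (abs_nonneg _) (hm _)) fun h0 ↦ ?_
    obtain ⟨h1, h2⟩ := (add_eq_zero_iff_of_nonneg (abs_nonneg _) (hm _)).1 h0.symm
    have : w.1 = w.2 := Subtype.ext (sub_eq_zero.1 (abs_eq_zero.1 h1))
    rw [this] at h2
    exact hdiag _ h2
  have hle (y : Y) (w : I × I) : sInf (f y '' Set.univ) ≤ f y w :=
    csInf_le (isCompact_univ.image (hfy y)).bddBelow ⟨w, trivial, rfl⟩
  refine ⟨⟨fun y ↦ sInf (f y '' Set.univ) / 2, by fun_prop⟩, fun y ↦ half_pos (hpos y),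
    fun y s t hst h0 ↦ ?_⟩
  have h1 := hle y (s, t)
  have h2 := hpos y
  simp only [f, h0] at h1 hst h2
  simp only [ContinuousMap.coe_mk] at hst
  linarith

/-- Homotopy lifting for a map whose nearby fibres are identified by a transport `τ`. -/
theorem exists_homotopy_lift_of_transport {X B Y : Type*} [TopologicalSpace X] [TopologicalSpace B]
    [TopologicalSpace Y] {p : X → B} {τ : X × B → X} {m : C(B × B, ℝ)} (hm : ∀ z, 0 ≤ m z)
    (hdiag : ∀ b, m (b, b) ≠ 0) (hpτ : ∀ x b, p (τ (x, b)) = b) (hτ : ∀ x, τ (x, p x) = x)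
    (hcont : ∀ x b, m (p x, b) ≠ 0 → ContinuousAt τ (x, b))
    (h : C(Y × I, B)) (f : C(Y, X)) (hf : ∀ y, p (f y) = h (y, 0)) :
    ∃ L : C(Y × I, X), (∀ y, L (y, 0) = f y) ∧ ∀ z, p (L z) = h z := by
  obtain ⟨δ, hδpos, hδ⟩ := exists_step h m hm hdiag
  -- the `j`-th stopping time
  let q : ℕ → Y × I → I := fun j z ↦ Set.projIcc 0 1 zero_le_one (min (j * δ z.1) z.2)
  have hqcont (j : ℕ) : Continuous (q j) := by
    refine continuous_projIcc.comp ?_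
    fun_prop
  have hqle (j : ℕ) (z : Y × I) : (q j z : ℝ) = min (j * δ z.1) z.2 := by
    have h0 : 0 ≤ (j : ℝ) * δ z.1 := mul_nonneg j.cast_nonneg (hδpos _).le
    simp only [q]
    rw [Set.projIcc_of_mem zero_le_one ⟨le_min h0 z.2.2.1, (min_le_right _ _).trans z.2.2.2⟩]
  have hq0 (z : Y × I) : q 0 z = 0 :=
    Subtype.ext ((hqle 0 z).trans (by simpa using z.2.2.1))
  have hqstep (j : ℕ) (z : Y × I) : |(q j z : ℝ) - q (j + 1) z| ≤ δ z.1 := by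
    rw [hqle, hqle, Nat.cast_succ, add_mul, one_mul]
    have := hδpos z.1
    refine (abs_min_sub_min_le_max _ _ _ _).trans ?_
    simp [abs_of_pos this, this.le]
  have hqlast (j : ℕ) (z : Y × I) (hj : 1 ≤ j * δ z.1) : q j z = z.2 :=
    Subtype.ext ((hqle j z).trans (min_eq_right (z.2.2.2.trans hj)))
  -- `P j` lifts the homotopy stopped at time min(jδ, t). Once the time has stopped, transport is
  -- the identity and `P` no longer changes.
  let P : ℕ → Y × I → X := fun j ↦ j.rec (fun z ↦ f z.1)
    fun j Pj z ↦ τ (Pj z, h (z.1, q (j + 1) z))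
  have hpP (j : ℕ) (z : Y × I) : p (P j z) = h (z.1, q j z) := by
    cases j with
    | zero => rw [hq0]; exact hf z.1
    | succ j => exact hpτ _ _
  have hPcont (j : ℕ) : Continuous (P j) := by
    induction j with
    | zero => exact f.continuous.comp continuous_fst
    | succ j ih =>
      refine continuous_iff_continuousAt.2 fun z ↦ ?_
      have h1 : ContinuousAt τ (P j z, h (z.1, q (j + 1) z)) :=
        hcont _ _ (by rw [hpP]; exact hδ _ _ _ (hqstep j z))
      exact h1.comp (f := fun z ↦ (P j z, h (z.1, q (j + 1) z)))
        (ih.prodMk (h.continuous.comp (continuous_fst.prodMk (hqcont _)))).continuousAt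
  have hPsucc (j : ℕ) (z : Y × I) (hz : q (j + 1) z = q j z) : P (j + 1) z = P j z := by
    change τ (P j z, h (z.1, q (j + 1) z)) = P j z
    rw [hz, ← hpP, hτ]
  have hPstable (j n : ℕ) (z : Y × I) (hj : 1 ≤ j * δ z.1) : P (j + n) z = P j z := by
    induction n with
    | zero => rfl
    | succ n ih =>
      have hle (i : ℕ) : 1 ≤ ((j + i : ℕ) : ℝ) * δ z.1 := by
        refine hj.trans (mul_le_mul_of_nonneg_right ?_ (hδpos _).le)
        exact_mod_cast Nat.le_add_right j i
      rw [← ih]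
      exact hPsucc _ z ((hqlast _ z (hle (n + 1))).trans (hqlast _ z (hle n)).symm)
  -- The strict inequality persists near `y`, so a fixed index computes the lift locally even though
  -- `N` need not be continuous.
  have hN (y : Y) : ∃ n : ℕ, 1 < n * δ y := by
    obtain ⟨n, hn⟩ := exists_nat_gt (1 / δ y)
    exact ⟨n, (div_lt_iff₀ (hδpos y)).1 hn⟩
  choose N hN using hN
  have hPeq (j : ℕ) (z : Y × I) (hj : 1 ≤ j * δ z.1) : P (N z.1) z = P j z := by
    rw [← hPstable j (N z.1) z hj, ← hPstable (N z.1) j z (hN z.1).le, add_comm]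
  refine ⟨⟨fun z ↦ P (N z.1) z, continuous_iff_continuousAt.2 fun z ↦ ?_⟩, fun y ↦ ?_, fun z ↦ ?_⟩
  · refine (hPcont (N z.1)).continuousAt.congr ?_
    have : ContinuousAt (fun w : Y × I ↦ N z.1 * δ w.1) z := by fun_prop
    filter_upwards [this.eventually_const_lt (hN z.1)] with w hw
    exact (hPeq _ w hw.le).symm
  · have h0 (j : ℕ) : q j (y, 0) = 0 := by
      refine Subtype.ext ((hqle j _).trans (min_eq_right ?_))
      exact mul_nonneg j.cast_nonneg (hδpos _).le
    have h1 (j : ℕ) : P j (y, 0) = f y := by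
      induction j with
      | zero => rfl
      | succ j ih => rw [hPsucc j _ ((h0 _).trans (h0 _).symm), ih]
    exact h1 _
  · change p (P (N z.1) z) = h z
    rw [hpP, hqlast _ z (hN z.1).le]

/-- Torus bundles with compact total space have the homotopy lifting property. -/
theorem IsTorusBundle.exists_homotopy_lift {X B Y : Type*} [TopologicalSpace X]
    [TopologicalSpace B] [TopologicalSpace Y] [CompactSpace X] [T2Space X] {k : ℕ}
    [MulAction (Fin k → Circle) X] [ContinuousSMul (Fin k → Circle) X] {p : X → B}
    (hp : IsTorusBundle k p) (h : C(Y × I, B)) (f : C(Y, X)) (hf : ∀ y, p (f y) = h (y, 0)) :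
    ∃ L : C(Y × I, X), (∀ y, L (y, 0) = f y) ∧ ∀ z, p (L z) = h z := by
  obtain ⟨τ, m, hm, hdiag, hpτ, hτ, hcont⟩ := hp.exists_transport
  exact exists_homotopy_lift_of_transport hm hdiag hpτ hτ hcont h f hf

end HomotopyLifting

/-! ### Contracting torus orbits in a simply connected space. -/

section TorusOrbit

open unitInterval

variable {X : Type*} [TopologicalSpace X] [SimplyConnectedSpace X]

theorem UnitAddCircle.homotopic_const (f : C(UnitAddCircle, X)) :
    (ContinuousMap.const _ (f 0)).Homotopic f := by
  let ℓ : Path (f 0) (f 0) :=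
    { toFun := fun s ↦ f (s : ℝ)
      continuous_toFun := by fun_prop
      source' := by simp
      target' := by
        change f ((1 : ℝ) : UnitAddCircle) = f 0
        rw [AddCircle.coe_period] }
  obtain ⟨H⟩ := SimplyConnectedSpace.paths_homotopic (Path.refl (f 0)) ℓ
  -- Currying the loop parameter first reduces descent to the circle to a statement about one map
  -- into C(I, X).
  let K : C(I, C(I, X)) := (H.toContinuousMap.comp ContinuousMap.prodSwap).curry
  let g : ℝ → C(I, X) := fun s ↦ K (Set.projIcc 0 1 zero_le_one s)
  have hg0 : g 0 = g (0 + 1) := by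
    ext r
    simp [g, K]
  have hcont : Continuous (AddCircle.liftIco 1 0 g) :=
    AddCircle.liftIco_continuous hg0 (K.continuous.comp continuous_projIcc).continuousOn
  have hg (s : ℝ) (hs : s ∈ Set.Ico (0 : ℝ) 1) (r : I) :
      AddCircle.liftIco 1 0 g s r = H (r, ⟨s, hs.1, hs.2.le⟩) := by
    rw [AddCircle.liftIco_zero_coe_apply hs]
    simp only [g]
    rw [Set.projIcc_of_mem zero_le_one ⟨hs.1, hs.2.le⟩]
    rfl
  refine ⟨{ toFun := fun w ↦ AddCircle.liftIco 1 0 g w.2 w.1,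
            continuous_toFun := by fun_prop,
            map_zero_left := fun z ↦ ?_, map_one_left := fun z ↦ ?_ }⟩
  all_goals
    obtain ⟨s, hs, rfl⟩ := AddCircle.eq_coe_Ico z
    refine (hg s hs _).trans ?_
    simp [ℓ]

theorem Circle.homotopic_const (f : C(Circle, X)) :
    (ContinuousMap.const _ (f 1)).Homotopic f := by
  let c := AddCircle.homeomorphCircle (T := (1 : ℝ)) one_ne_zero
  have h := (UnitAddCircle.homotopic_const (f.comp c)).comp (.refl (c.symm : C(Circle, UnitAddCircle)))
  have h0 : c 0 = 1 := by simp [c, AddCircle.homeomorphCircle_apply]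
  convert h using 1
  · ext z
    simp [h0]
  · ext z
    simp

/-- Orbits of a torus acting on a simply connected space contract. -/
theorem torus_orbit_homotopic_const {k : ℕ} [MulAction (Fin k → Circle) X]
    [ContinuousSMul (Fin k → Circle) X] (x : X) :
    (ContinuousMap.const (Fin k → Circle) x).Homotopic ⟨fun t ↦ t • x, by fun_prop⟩ := by
  have hcont (i : Fin k) : Continuous fun c : Circle ↦ (Pi.mulSingle i c : Fin k → Circle) :=
    continuous_mulSingle (A := fun _ : Fin k ↦ Circle) i
  have hprod (s : Finset (Fin k)) :
      Continuous fun t : Fin k → Circle ↦ (∏ i ∈ s, Pi.mulSingle i (t i) : Fin k → Circle) :=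
    continuous_finsetProd _ fun i _ ↦ (hcont i).comp (continuous_apply i)
  have key (s : Finset (Fin k)) : (ContinuousMap.const (Fin k → Circle) x).Homotopic
      ⟨fun t ↦ (∏ i ∈ s, Pi.mulSingle i (t i) : Fin k → Circle) • x,
        (hprod s).smul continuous_const⟩ := by
    induction s using Finset.induction_on with
    | empty =>
      convert ContinuousMap.Homotopic.refl _
      simp
    | insert i s hi ih =>
      obtain ⟨H⟩ := Circle.homotopic_const
        (⟨fun c ↦ (Pi.mulSingle i c : Fin k → Circle) • x, (hcont i).smul continuous_const⟩ :
          C(Circle, X))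
      -- One circle factor is contracted at a time, and the contraction is translated by the
      -- remaining factors.
      refine ih.trans ⟨{
        toFun := fun w ↦ (∏ j ∈ s, Pi.mulSingle j (w.2 j) : Fin k → Circle) • H (w.1, w.2 i)
        continuous_toFun := ((hprod s).comp continuous_snd).smul (by fun_prop)
        map_zero_left := fun t ↦ ?_
        map_one_left := fun t ↦ ?_ }⟩
      · simp
      · simp only [ContinuousMap.Homotopy.apply_one, ContinuousMap.coe_mk, Finset.prod_insert hi]
        rw [← mul_smul, mul_comm]
  convert key Finset.univ with t
  exact (Finset.univ_prod_mulSingle t).symm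

end TorusOrbit

/-! ### Path algebra, continuous in families of loops. -/

section LoopFamilies

open unitInterval

variable {X Z : Type*} [TopologicalSpace X] [TopologicalSpace Z] {x : X}

/-- The concatenation reparametrises γ by φ, and φ is joined to the identity by a straight line. -/
theorem homotopic_trans_refl (γ : C(Z, Path x x)) :
    ContinuousMap.Homotopic ⟨fun z ↦ (γ z).trans (.refl x), by fun_prop⟩ γ := by
  let φ : I → I := fun t ↦
    ⟨Path.Homotopy.transReflReparamAux t, Path.Homotopy.transReflReparamAux_mem_I t⟩
  have hφ : Continuous φ := by fun_prop
  have hφ0 : φ 0 = 0 := Subtype.ext Path.Homotopy.transReflReparamAux_zero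
  have hφ1 : φ 1 = 1 := Subtype.ext Path.Homotopy.transReflReparamAux_one
  let K : I × I → I := fun w ↦ ⟨(1 - (w.1 : ℝ)) * φ w.2 + w.1 * w.2,
    convex_Icc (0 : ℝ) 1 (φ w.2).2 w.2.2 
      (sub_nonneg.2 w.1.2.2) w.1.2.1 (by ring)⟩
  have hK : Continuous K := by fun_prop
  let F : I × Z → Path x x := fun w ↦
    { toFun := fun u ↦ γ w.2 (K (w.1, u))
      continuous_toFun := by fun_prop
      source' := by
        have : K (w.1, 0) = 0 := Subtype.ext (by simp [K, hφ0])
        rw [this, Path.source]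
      target' := by
        have : K (w.1, 1) = 1 := Subtype.ext (by simp [K, hφ1])
        rw [this, Path.target] }
  refine ⟨{ toFun := F, continuous_toFun := ?_, map_zero_left := fun z ↦ ?_,
            map_one_left := fun z ↦ ?_ }⟩
  · rw [← Path.continuous_uncurry_iff]
    change Continuous fun w : (I × Z) × I ↦ γ w.1.2 (K (w.1.1, w.2))
    fun_prop
  · refine .trans ?_ (Path.Homotopy.trans_refl_reparam (γ z)).symm
    ext u
    exact congrArg (γ z) (Subtype.ext (by simp [K, φ]))
  · ext u
    exact congrArg (γ z) (Subtype.ext (by simp [K]))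

/-- In a continuous family of loops, a backtrack may be cancelled. -/
theorem homotopic_trans_symm_trans (γ d : C(Z, Path x x)) :
    ContinuousMap.Homotopic ⟨fun z ↦ ((γ z).trans (d z).symm).trans (d z),
      (γ.continuous.path_trans (Path.continuous_symm.comp d.continuous)).path_trans d.continuous⟩ γ := by
  -- The backtrack grows with `w.1`: it goes along the initial stretch of the reversed `d` and
  -- returns.
  let E (w : I × Z) : Path x ((d w.2).symm w.1) :=
    { toFun := fun u ↦ (d w.2).symm (w.1 * u)
      continuous_toFun := by fun_prop
      source' := by simp
      target' := by simp }
  have hE : Continuous ↿E := by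
    change Continuous fun w : (I × Z) × I ↦ d w.1.2 (σ (w.1.1 * w.2))
    fun_prop
  let F : I × Z → Path x x := fun w ↦ ((γ w.2).trans (E w)).trans (E w).symm
  have hF : Continuous F := by
    rw [← Path.continuous_uncurry_iff]
    refine Path.trans_continuous_family _ (Path.trans_continuous_family _ ?_ _ hE) _
      (Path.symm_continuous_family _ hE)
    change Continuous fun w : (I × Z) × I ↦ γ w.1.2 w.2
    fun_prop
  have h1 : ContinuousMap.Homotopic ⟨fun z ↦ F (0, z), by fun_prop⟩
      ⟨fun z ↦ F (1, z), by fun_prop⟩ :=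
    ⟨{ toFun := F, continuous_toFun := hF, map_zero_left := fun _ ↦ rfl,
       map_one_left := fun _ ↦ rfl }⟩
  have h0 := (homotopic_trans_refl (⟨fun z ↦ (γ z).trans (.refl x), by fun_prop⟩ :
    C(Z, Path x x))).trans (homotopic_trans_refl γ)
  convert h1.symm.trans ?_ using 1
  · ext z u
    simp [F, E, Path.trans_apply]
  · convert h0 using 1
    ext z u
    simp [F, E, Path.trans_apply]

end LoopFamilies

/-! ### Comparing ΩX and ΩB. -/

section LoopSpaces

open unitInterval

namespace IsTorusBundle

section Division

variable {X B W : Type*} [TopologicalSpace X] [TopologicalSpace B] [CompactSpace X] [T2Space X]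
  [TopologicalSpace W] {k : ℕ} [MulAction (Fin k → Circle) X]
  [ContinuousSMul (Fin k → Circle) X] {p : X → B}

theorem exists_division (hp : IsTorusBundle k p) (f g : C(W, X)) (hfg : ∀ w, p (f w) = p (g w)) :
    ∃ t : C(W, Fin k → Circle), ∀ w, t w • f w = g w := by
  choose t ht using fun w ↦ (hp.apply_eq_iff _ _).1 (hfg w)
  have hcont : Continuous fun w ↦ (t w, f w) := by
    rw [hp.isClosedEmbedding.isInducing.continuous_iff]
    change Continuous fun w ↦ (f w, t w • f w)
    simp only [ht]
    fun_prop
  exact ⟨⟨t, continuous_fst.comp hcont⟩, ht⟩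

omit [CompactSpace X] [T2Space X] [ContinuousSMul (Fin k → Circle) X] in
theorem eq_of_smul_eq (hp : IsTorusBundle k p) {s t : Fin k → Circle} {x : X}
    (h : s • x = t • x) : s = t := by
  have := hp.free (t⁻¹ * s) x (by rw [mul_smul, inv_smul_eq_iff]; exact h)
  exact (inv_mul_eq_one.1 this).symm

end Division

variable {X B : Type u} [TopologicalSpace X] [TopologicalSpace B] [CompactSpace X] [T2Space X]
  [SimplyConnectedSpace X] {k : ℕ} [MulAction (Fin k → Circle) X]
  [ContinuousSMul (Fin k → Circle) X] {p : X → B}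

/-- For a torus bundle with simply connected total space, the loop spaces of the total space and
of the base have torsion-free homology at the same time. -/
theorem homologyTorsionFree_loopSpace_iff (hp : IsTorusBundle k p) (x : X) :
    HomologyTorsionFree (LoopSpace X x) ↔ HomologyTorsionFree (LoopSpace B (p x)) := by
  have hpc : Continuous p := hp.isOpenQuotientMap.continuous
  have hsmul (t : Fin k → Circle) (y : X) : p (t • y) = p y :=
    ((hp.apply_eq_iff _ _).2 ⟨t, rfl⟩).symm
  -- paths along which the orbit of `x` contracts
  obtain ⟨H⟩ := torus_orbit_homotopic_const (k := k) x
  let c (t : Fin k → Circle) : Path x (t • x) :=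
    { toFun := fun s ↦ H (s, t)
      continuous_toFun := by fun_prop
      source' := by simp
      target' := by simp }
  have hca (t : Fin k → Circle) (s : I) : c t s = H (s, t) := rfl
  have hc : Continuous ↿c := H.continuous.comp continuous_swap
  -- lifts of loops, and their endpoints
  obtain ⟨L, hL0, hLp⟩ := hp.exists_homotopy_lift
    (⟨fun w : Path (p x) (p x) × I ↦ w.1 w.2, by fun_prop⟩) (.const _ x) (fun γ ↦ by simp)
  replace hLp (γ : Path (p x) (p x)) (s : I) : p (L (γ, s)) = γ s := hLp (γ, s)
  obtain ⟨μ, hμ⟩ := hp.exists_division (.const _ x)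
    (⟨fun γ ↦ L (γ, 1), by fun_prop⟩ : C(Path (p x) (p x), X)) (fun γ ↦ by simp [hLp])
  replace hμ (γ : Path (p x) (p x)) : μ γ • x = L (γ, 1) := hμ γ
  let l (γ : Path (p x) (p x)) : Path x (μ γ • x) :=
    { toFun := fun s ↦ L (γ, s)
      continuous_toFun := by fun_prop
      source' := hL0 γ
      target' := (hμ γ).symm }
  have hl : Continuous ↿l := L.continuous
  have hla (γ : Path (p x) (p x)) (s : I) : l γ s = L (γ, s) := rfl
  let r : C(Path (p x) (p x), Path x x) := ⟨fun γ ↦ (l γ).trans (c (μ γ)).symm, by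
    rw [← Path.continuous_uncurry_iff]
    refine Path.trans_continuous_family _ hl _ (Path.symm_continuous_family _ ?_)
    exact hc.comp (f := fun w : Path (p x) (p x) × I ↦ (μ w.1, w.2)) (by fun_prop)⟩
  let pΩ : C(Path x x, Path (p x) (p x)) := ⟨fun α ↦ α.map hpc, by
    rw [← Path.continuous_uncurry_iff]
    change Continuous fun w : Path x x × I ↦ p (w.1 w.2)
    fun_prop⟩
  constructor
  · intro hX
    -- The contracting paths project to loops in B. Since p(r γ) is γ followed by the reverse of `d
    -- (μ γ)`, appending `d (μ γ)` recovers γ up to homotopy.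
    let d : C(Fin k → Circle, Path (p x) (p x)) :=
      ⟨fun t ↦ ((c t).map hpc).cast rfl (hsmul t x).symm, by
        rw [← Path.continuous_uncurry_iff]
        exact hpc.comp hc⟩
    refine (hX.prod_torus k).of_retract ⟨fun γ ↦ (r γ, μ γ), by fun_prop⟩
      ⟨fun w ↦ (pΩ w.1).trans (d w.2), by fun_prop⟩ ?_
    have hr (γ : Path (p x) (p x)) : pΩ (r γ) = γ.trans (d (μ γ)).symm := by
      ext s
      simp only [pΩ, r, d, ContinuousMap.coe_mk, Path.map_coe, Path.trans_apply, Path.symm_apply,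
        Path.cast_coe, Function.comp_apply, apply_dite p, hla, hLp]
    convert homotopic_trans_symm_trans (.id _) (d.comp μ) using 1
    ext γ s
    simp [hr]
  · intro hB
    obtain ⟨τ, hτ⟩ := hp.exists_division (⟨fun w ↦ w.1 w.2, by fun_prop⟩ : C(Path x x × I, X))
      ⟨fun w ↦ L (pΩ w.1, w.2), by fun_prop⟩ (fun w ↦ (hLp (pΩ w.1) w.2).symm)
    replace hτ (α : Path x x) (s : I) : τ (α, s) • α s = L (pΩ α, s) := hτ (α, s)
    have hτ0 (α : Path x x) : τ (α, 0) = 1 :=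
      hp.free _ x (by simpa [hL0] using hτ α 0)
    have hτ1 (α : Path x x) : τ (α, 1) = μ (pΩ α) :=
      hp.eq_of_smul_eq (x := x) (by simpa [hμ] using hτ α 1)
    -- The contraction of the orbit need not fix `x`, so `c 1` may be a nonconstant loop and has to
    -- be cancelled.
    let c₁ : Path x x := (c 1).cast rfl (one_smul _ x).symm
    -- α and the chosen lift of p ∘ α differ by τ. Slowing τ down by the factor `w.1` deforms α into
    -- that lift, with the endpoint moving along the orbit of `x`.
    let A (w : I × Path x x) : Path x (τ (w.2, w.1) • x) :=
      { toFun := fun u ↦ τ (w.2, w.1 * u) • w.2 u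
        continuous_toFun := by fun_prop
        source' := by simp [hτ0]
        target' := by simp }
    have hAa (w : I × Path x x) (u : I) : A w u = τ (w.2, w.1 * u) • w.2 u := rfl
    have hA : Continuous ↿A := by
      change Continuous fun v : (I × Path x x) × I ↦ τ (v.1.2, v.1.1 * v.2) • v.1.2 v.2
      fun_prop
    let K (w : I × Path x x) : Path x x := ((A w).trans (c (τ (w.2, w.1))).symm).trans c₁
    have hK : Continuous K := by
      rw [← Path.continuous_uncurry_iff]
      refine Path.trans_continuous_family _ (Path.trans_continuous_family _ hA _
        (Path.symm_continuous_family _ ?_)) _ ?_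
      · exact hc.comp (f := fun v : (I × Path x x) × I ↦ (τ (v.1.2, v.1.1), v.2)) (by fun_prop)
      · change Continuous fun v : (I × Path x x) × I ↦ c₁ v.2
        fun_prop
    have hK0 (α : Path x x) : K (0, α) = (α.trans c₁.symm).trans c₁ := by
      ext u
      simp only [K, c₁, Path.trans_apply, Path.symm_apply, Path.cast_coe, Function.comp_apply, hAa,
        hca, zero_mul, hτ0, one_smul]
    have hK1 (α : Path x x) : K (1, α) = (r (pΩ α)).trans c₁ := by
      ext u
      simp only [K, c₁, r, ContinuousMap.coe_mk, Path.trans_apply, Path.symm_apply, Path.cast_coe,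
        Function.comp_apply, hAa, hca, hla, one_mul, hτ1, hτ]
    refine hB.of_retract pΩ ⟨fun γ ↦ (r γ).trans c₁, by fun_prop⟩ ?_
    refine ContinuousMap.Homotopic.trans ?_ (homotopic_trans_symm_trans (.id _) (.const _ c₁))
    refine ContinuousMap.Homotopic.symm ⟨?_⟩
    exact
      { toFun := K
        continuous_toFun := hK
        map_zero_left := hK0
        map_one_left := hK1 }

end IsTorusBundle

end LoopSpaces

/-! ### The torus bundle G/H → G/(T×H). -/

section CosetSpaces

variable {G : Type u} [Group G] {T H : Subgroup G}

theorem Subgroup.mem_sup_of_commute (hcomm : ∀ t ∈ T, ∀ h ∈ H, Commute t h) {g : G} :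
    g ∈ T ⊔ H ↔ ∃ t ∈ T, ∃ h ∈ H, t * h = g := by
  have := MonoidHom.noncommCoprod_range T.subtype H.subtype fun t h ↦ hcomm t t.2 h h.2
  rw [T.range_subtype, H.range_subtype] at this
  rw [← this, MonoidHom.mem_range]
  constructor
  · rintro ⟨⟨t, h⟩, rfl⟩
    exact ⟨t, t.2, h, h.2, rfl⟩
  · rintro ⟨t, ht, h, hh, rfl⟩
    exact ⟨(⟨t, ht⟩, ⟨h, hh⟩), rfl⟩

/-- The action of a torus commuting with `H` on `G ⧸ H`, by multiplication on the right. -/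
noncomputable abbrev cosetTorusAction [TopologicalSpace G] {k : ℕ} (e : T ≃ₜ* (Fin k → Circle))
    (hcomm : ∀ t ∈ T, ∀ h ∈ H, Commute t h) : MulAction (Fin k → Circle) (G ⧸ H) where
  smul t := Quotient.map' (fun g ↦ g * (e.symm t : G)) fun a b hab ↦ by
    rw [QuotientGroup.leftRel_apply] at hab ⊢
    have := hcomm _ (e.symm t).2 _ hab
    rwa [mul_inv_rev, mul_assoc, ← mul_assoc a⁻¹, ← this.eq, inv_mul_cancel_left]
  one_smul := by
    rintro ⟨g⟩
    change (QuotientGroup.mk (g * (e.symm 1 : T)) : G ⧸ H) = QuotientGroup.mk g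
    simp
  mul_smul s t := by
    rintro ⟨g⟩
    change (QuotientGroup.mk (g * (e.symm (s * t) : T)) : G ⧸ H) =
      QuotientGroup.mk (g * (e.symm t : T) * (e.symm s : T))
    -- Right multiplication reverses products; commutativity of the torus makes it a left action.
    rw [mul_comm s t, map_mul, Subgroup.coe_mul, mul_assoc]

theorem t2Space_quotient [TopologicalSpace G] [IsTopologicalGroup G]
    (hH : IsClosed (H : Set G)) : T2Space (G ⧸ H) := by
  rw [t2Space_iff_of_isOpenQuotientMap QuotientGroup.isOpenQuotientMap_mk]
  simp only [QuotientGroup.eq]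
  exact hH.preimage (f := fun q : G × G ↦ q.1⁻¹ * q.2) (by fun_prop)

/-- Triviality of T ∩ H gives freeness, T ⊔ H = TH identifies the fibres with orbits, and closedness
of `H` makes G/H Hausdorff. -/
theorem homologyTorsionFree_cosetLoopSpace_iff [TopologicalSpace G] [IsTopologicalGroup G]
    [CompactSpace G] (hH : IsClosed (H : Set G)) [SimplyConnectedSpace (G ⧸ H)] {k : ℕ}
    (hT : IsTorusOfDim T k) (hcomm : ∀ t ∈ T, ∀ h ∈ H, Commute t h) (hdisj : Disjoint T H) :
    HomologyTorsionFree (CosetLoopSpace H) ↔ HomologyTorsionFree (CosetLoopSpace (T ⊔ H)) := by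
  obtain ⟨e⟩ := hT
  let := cosetTorusAction e hcomm
  have hmk (t : Fin k → Circle) (g : G) :
      t • (QuotientGroup.mk g : G ⧸ H) = QuotientGroup.mk (g * (e.symm t : T)) := rfl
  have : ContinuousSMul (Fin k → Circle) (G ⧸ H) := by
    refine ⟨?_⟩
    rw [← (IsOpenQuotientMap.id.prodMap QuotientGroup.isOpenQuotientMap_mk).continuous_comp_iff]
    exact QuotientGroup.continuous_mk.comp (f := fun w : (Fin k → Circle) × G ↦
      w.2 * (e.symm w.1 : T)) (continuous_snd.mul
        (continuous_subtype_val.comp (e.symm.continuous.comp continuous_fst)))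
  have := t2Space_quotient hH
  let p : G ⧸ H → G ⧸ (T ⊔ H) := Subgroup.quotientMapOfLE le_sup_right
  have hp : IsTorusBundle k p :=
    { isOpenQuotientMap := by
        have hcont : Continuous p :=
          (QuotientGroup.isOpenQuotientMap_mk.continuous_comp_iff (g := p)).1
            QuotientGroup.continuous_mk
        exact .of_comp QuotientGroup.continuous_mk QuotientGroup.mk_surjective hcont
          QuotientGroup.isOpenQuotientMap_mk
      free := by
        rintro t ⟨g⟩ ht
        have h1 : ((e.symm t : T) : G) ∈ H := by
          have := QuotientGroup.eq.1 ht.symm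
          rwa [inv_mul_cancel_left] at this
        have h2 := Subgroup.disjoint_def.1 hdisj (e.symm t).2 h1
        exact (map_eq_one_iff e.symm e.symm.injective).1 (Subtype.ext h2)
      apply_eq_iff := by
        rintro ⟨a⟩ ⟨b⟩
        change (QuotientGroup.mk a : G ⧸ (T ⊔ H)) = QuotientGroup.mk b ↔
          ∃ t : Fin k → Circle, (QuotientGroup.mk (a * (e.symm t : T)) : G ⧸ H) = QuotientGroup.mk b
        rw [QuotientGroup.eq, Subgroup.mem_sup_of_commute hcomm]
        constructor
        · rintro ⟨t, ht, h, hh, hth⟩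
          refine ⟨e ⟨t, ht⟩, QuotientGroup.eq.2 ?_⟩
          have : (a * t)⁻¹ * b = h := by rw [mul_inv_rev, mul_assoc, ← hth, inv_mul_cancel_left]
          rw [e.symm_apply_apply, this]
          exact hh
        · rintro ⟨t, ht⟩
          refine ⟨e.symm t, (e.symm t).2, _, QuotientGroup.eq.1 ht, ?_⟩
          group }
  exact hp.homologyTorsionFree_loopSpace_iff (QuotientGroup.mk 1)

end CosetSpaces

theorem proposition2p1
    {E : Type*} [NormedAddCommGroup E] [NormedSpace ℝ E] [FiniteDimensional ℝ E]
    (G : Type u) [TopologicalSpace G] [ChartedSpace E G] [Group G] [LieGroup 𝓘(ℝ, E) ∞ G]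
    [T2Space G] [CompactSpace G] [ConnectedSpace G]
    (H : Subgroup G) (hHclosed : IsClosed (H : Set G)) (hHconn : IsConnected (H : Set G))
    (hGH : SimplyConnectedSpace (G ⧸ H))
    (k : ℕ) (hk : (k : ℕ∞) + lieRank H ≤ lieRank G)
    -- `T` is a `k`-torus in `G` and `T ⊔ H` is the internal direct product of `T` and `H`
    (T : Subgroup G) (hT : IsTorusOfDim T k)
    (hcomm : ∀ t ∈ T, ∀ h ∈ H, Commute t h) (hdisj : Disjoint T H) :
    HomologyTorsionFree (CosetLoopSpace H) ↔ HomologyTorsionFree (CosetLoopSpace (T ⊔ H)) := by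
  have := topologicalGroup_of_lieGroup 𝓘(ℝ, E) ∞ (G := G)
  exact homologyTorsionFree_cosetLoopSpace_iff hHclosed hT hcomm hdisj
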